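/- Let $\varphi:\mathbb R\to\mathbb R$ be an Orlicz N-function, i.e. a continuous, even, convex function, increasing on $(0,\infty)$, with $\varphi(0)=0$, $\varphi(x)/x\to0$ as $x\to0$ and $\varphi(x)/x\to\infty$ as $x\to\infty$; let $\varphi^{(-1)}$ be its inverse on $[0,\infty)$ and assume $\varphi^{(-1)}(1)=1$. For a real random variable $Y$ put $$\|Y\|_{\tau_{\tilde\varphi}}=\sup_{p\ge1}\frac{\|Y\|_p}{\varphi^{(-1)}(p)}\in[0,\infty],\qquad \|Y\|_p=(E|Y|^p)^{1/p}.$$ Let $X_1,\dots,X_n$ ($n\ge1$) be independent, identically distributed (strongly measurable) random variables with values in a real Banach space $(\Omega,\|\cdot\|)$, let $L\in\mathbb R$, and let $\mathcal G$ be a class of functions $g:\Omega\to\mathbb R$ with $g(x)-g(y)\le L\|x-y\|$ for all $g\in\mathcal G$ and $x,y\in\Omega$. For $x\in\Omega^n$ let $$\mathcal L(\mathcal G,x)=\frac2n\,E_\epsilon\Big[\sup_{g\in\mathcal G}\sum_{i=1}^n\epsilon_i g(x_i)\Big],$$ where $\epsilon_1,\dots,\epsilon_n$ are independent and uniformly distributed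 on $\{-1,1\}$. Suprema and expectations of suprema are taken in the extended reals, and $0\cdot\infty=0$. If $\delta>0$ and $n\ge\ln(1/\delta)\ge1$, then with probability at least $1-\delta$ $$\sup_{g\in\mathcal G}\Big(\frac1n\sum_{i=1}^n g(X_i)-E[g(X_1)]\Big)\le E[\mathcal L(\mathcal G,X)]+12\,e\,L\,\big\|\,\|X_1\|\,\big\|_{\tau_{\tilde\varphi}}\sqrt{\frac{\ln(1/\delta)}n}.$$ -/

import Mathlib

open MeasureTheory ProbabilityTheory Filter Topology
open scoped ENNReal

noncomputable section

/-- An Orlicz N-function: a continuous, even, convex function on the real line, increasing on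
`(0, ∞)`, with `φ 0 = 0`, `φ x / x → 0` as `x → 0` and `φ x / x → ∞` as `x → ∞`. -/
structure IsOrliczNFunction (φ : ℝ → ℝ) : Prop where
  continuous : Continuous φ
  even : ∀ x, φ (-x) = φ x
  convex : ConvexOn ℝ Set.univ φ
  monotone : MonotoneOn φ (Set.Ioi 0)
  map_zero : φ 0 = 0
  tendsto_zero : Tendsto (fun x => φ x / x) (𝓝[≠] 0) (𝓝 0)
  tendsto_atTop : Tendsto (fun x => φ x / x) atTop atTop

/-- The inverse `φ⁻¹` of an Orlicz N-function restricted to `[0, ∞)`. See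
`orliczInv_eq` for the fact that it is the inverse function. -/
def orliczInv (φ : ℝ → ℝ) (y : ℝ) : ℝ :=
  sInf {x : ℝ | 0 ≤ x ∧ y ≤ φ x}

/-- For `y > 0` the number `orliczInv φ y` is the only nonnegative solution of `φ x = y`. -/
theorem orliczInv_eq {φ : ℝ → ℝ} (hφ : IsOrliczNFunction φ) {x y : ℝ}
    (hx : 0 ≤ x) (hy : 0 < y) (h : φ x = y) : orliczInv φ y = x := by
  have hlb : ∀ z ∈ {x : ℝ | 0 ≤ x ∧ y ≤ φ x}, x ≤ z := by
    rintro z ⟨hz, hyz⟩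
    by_contra! hlt
    have hxpos : 0 < x := lt_of_le_of_lt hz hlt
    have hc := hφ.convex.2 (Set.mem_univ x) (Set.mem_univ (0 : ℝ))
      (div_nonneg hz hx) (sub_nonneg.2 ((div_le_one hxpos).2 hlt.le)) (by ring)
    have e1 : (z / x) • x + (1 - z / x) • (0 : ℝ) = z := by
      simp only [smul_eq_mul, mul_zero, add_zero]
      field_simp
    rw [e1, hφ.map_zero, h] at hc
    simp only [smul_eq_mul, mul_zero, add_zero] at hc
    have h1 : z / x < 1 := (div_lt_one hxpos).2 hlt
    nlinarith
  exact (IsLeast.csInf_eq ⟨⟨hx, h.ge⟩, hlb⟩)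

/-- The norm `sup_{p ≥ 1} ‖Y‖_p / φ⁻¹(p)` of a real random variable, with values in `[0, ∞]`. -/
def tauNorm {Ω : Type*} [MeasurableSpace Ω] (φ : ℝ → ℝ) (Y : Ω → ℝ) (μ : Measure Ω) : ℝ≥0∞ :=
  ⨆ (p : ℝ) (_ : 1 ≤ p), eLpNorm Y (ENNReal.ofReal p) μ / ENNReal.ofReal (orliczInv φ p)

/-- The (empirical) Rademacher complexity of a class `G` at the sample `x`, that is
`(2 / n) 𝔼_ε sup_{g ∈ G} ∑ i, ε i * g (x i)` with `ε` uniform on `{-1, 1}ⁿ`. For a nonempty class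
it lies in `[0, ∞]`; the value `∞` is possible. -/
def rademacherComplexity {E : Type*} {n : ℕ} (G : Set (E → ℝ)) (x : Fin n → E) : EReal :=
  ((2 / (n : ℝ) * (1 / 2 ^ n) : ℝ) : EReal) *
    ∑ ε : Fin n → ℤˣ, ⨆ g ∈ G, ((∑ i, ((ε i : ℤ) : ℝ) * g (x i) : ℝ) : EReal)

/-- The expectation `𝔼 f⁺ - 𝔼 f⁻` of an extended-real-valued random variable. -/
def extExpectation {Ω : Type*} [MeasurableSpace Ω] (μ : Measure Ω) (f : Ω → EReal) : EReal :=
  ((∫⁻ ω, (f ω).toENNReal ∂μ : ℝ≥0∞) : EReal) - ((∫⁻ ω, (-f ω).toENNReal ∂μ : ℝ≥0∞) : EReal)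

end

/-! The N-function enters only through its growth: convexity, `φ 0 = 0` and the normalization give
`φ⁻¹(p) ≤ p` for `p ≥ 1`. So with `K` the tau-norm of `‖X₁‖` one has `E‖X₁‖^k ≤ (K k)^k`, that is,
the norm is sub-exponential.

If `f` has Lipschitz constant `c` on one coordinate, then `|f - E f| ≤ c (‖x‖ + E‖X₁‖)`. In the
moment generating function of `f - E f` the linear term vanishes by centring, and `k^k / k! ≤ e^k`
bounds the remaining terms by a geometric series (`lintegral_exp_lipschitz_le`). Integrating out one
coordinate at a time multiplies these bounds (`lintegral_exp_pi_le`), and Markov's inequality for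
the exponential gives a Bernstein tail (`measure_sub_integral_le_ge`); `ln(1/δ) ≤ n` keeps it in its
Gaussian range. The uniform deviation has constant `L / n` in each coordinate, so it concentrates
around its mean, which a ghost sample and random signs bound by the expected Rademacher complexity
(`integral_supDeviation_le`).

This argument needs finite suprema, a finite positive tau-norm, `L > 0` and a separable space.
Strong measurability puts the sample in a closed separable subspace. If `L ≤ 0` or the tau-norm is
zero, the deviation vanishes almost surely; if the tau-norm is infinite, or the class is unbounded
at `0` (`rademacherComplexity_eq_top_of_unbounded`), the right side is `⊤`. -/

/-! ### Exponential moments from sub-exponential moments. -/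

/-- `exp W - W = 1 + ∑ W ^ (k + 2) / (k + 2)!`. -/
theorem hasSum_exp_sub_self_sub_one (x : ℝ) :
    HasSum (fun k : ℕ => x ^ (k + 2) / ((k + 2).factorial : ℝ)) (Real.exp x - x - 1) := by
  have h := NormedSpace.expSeries_div_hasSum_exp x
  rw [← Real.exp_eq_exp_ℝ] at h
  have := (hasSum_nat_add_iff' 2).2 h
  simp only [Finset.sum_range_succ, Finset.range_zero, Finset.sum_empty, pow_zero, pow_one,
    Nat.factorial_zero, Nat.factorial_one, Nat.cast_one, div_one, zero_add] at this
  rwa [sub_sub, add_comm x 1]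

theorem exp_sub_self_mono {x y : ℝ} (hx : 0 ≤ x) (hxy : x ≤ y) :
    Real.exp x - x ≤ Real.exp y - y := by
  have h1 := Real.add_one_le_exp (y - x)
  have h2 : Real.exp y = Real.exp x * Real.exp (y - x) := by rw [← Real.exp_add]; ring_nf
  have h3 := Real.one_le_exp hx
  rw [h2]
  nlinarith

/-- For negative `u` this is `sinh |u| ≥ |u|`. The point is that a centred `u` integrates to zero,
which leaves a function of `|u|` without a first-order term. -/
theorem exp_le_exp_abs_sub_abs_add (u : ℝ) : Real.exp u ≤ Real.exp |u| - |u| + u := by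
  rcases le_total 0 u with h | h
  · rw [abs_of_nonneg h]; linarith
  · rw [abs_of_nonpos h]
    have := Real.self_le_sinh_iff.2 (neg_nonneg.2 h)
    rw [Real.sinh_eq, neg_neg] at this
    linarith

/-- A sub-exponential moment bound gives control on `E (exp W - W)`. -/
theorem lintegral_exp_sub_self_le {α : Type*} [MeasurableSpace α] {ν : Measure α}
    [IsProbabilityMeasure ν] {W : α → ℝ} (hW : Measurable W) (hW0 : ∀ x, 0 ≤ W x) {b : ℝ}
    (hb : 0 ≤ b) (hint : ∀ k : ℕ, 1 ≤ k → Integrable (fun x => W x ^ k) ν)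
    (hmom : ∀ k : ℕ, 1 ≤ k → ∫ x, W x ^ k ∂ν ≤ (b * k) ^ k) (hb1 : Real.exp 1 * b < 1) :
    ∫⁻ x, ENNReal.ofReal (Real.exp (W x) - W x) ∂ν ≤
      ENNReal.ofReal (Real.exp ((Real.exp 1 * b) ^ 2 / (1 - Real.exp 1 * b))) := by
  set a := Real.exp 1 * b with ha
  have ha0 : 0 ≤ a := by positivity
  have hgeo : HasSum (fun k : ℕ => a ^ (k + 2)) (a ^ 2 / (1 - a)) := by
    have := (hasSum_geometric_of_lt_one ha0 hb1).mul_left (a ^ 2)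
    simpa [pow_add, mul_comm, div_eq_mul_inv] using this
  have hpt : ∀ x, ENNReal.ofReal (Real.exp (W x) - W x) =
      1 + ∑' k : ℕ, ENNReal.ofReal (W x ^ (k + 2) / ((k + 2).factorial : ℝ)) := by
    intro x
    have hs := hasSum_exp_sub_self_sub_one (W x)
    have hn : ∀ k : ℕ, 0 ≤ W x ^ (k + 2) / ((k + 2).factorial : ℝ) := fun k =>
      div_nonneg (pow_nonneg (hW0 x) _) (Nat.cast_nonneg _)
    rw [← ENNReal.ofReal_tsum_of_nonneg hn hs.summable, hs.tsum_eq, ← ENNReal.ofReal_one,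
      ← ENNReal.ofReal_add zero_le_one (hs.nonneg hn)]
    congr 1
    ring
  have hterm : ∀ k : ℕ, ∫⁻ x, ENNReal.ofReal (W x ^ (k + 2) / ((k + 2).factorial : ℝ)) ∂ν ≤
      ENNReal.ofReal (a ^ (k + 2)) := by
    intro k
    rw [← ofReal_integral_eq_lintegral_ofReal ((hint (k + 2) (by omega)).div_const _)
      (ae_of_all _ fun x => div_nonneg (pow_nonneg (hW0 x) _) (Nat.cast_nonneg _)),
      integral_div]
    apply ENNReal.ofReal_le_ofReal
    -- One term of the exponential series at `k + 2` gives `(k + 2)^(k + 2) / (k + 2)! ≤ e^(k + 2)`;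
    -- this is the source of the factor `e` in the theorem.
    have h1 := Real.pow_div_factorial_le_exp ((k + 2 : ℕ) : ℝ) (Nat.cast_nonneg _) (k + 2)
    have h2 : Real.exp ((k + 2 : ℕ) : ℝ) = Real.exp 1 ^ (k + 2) := by
      rw [← Real.exp_nat_mul, mul_one]
    calc (∫ x, W x ^ (k + 2) ∂ν) / ((k + 2).factorial : ℝ)
        ≤ (b * (k + 2 : ℕ)) ^ (k + 2) / ((k + 2).factorial : ℝ) := by
          gcongr
          exact hmom (k + 2) (by omega)
      _ = b ^ (k + 2) * (((k + 2 : ℕ) : ℝ) ^ (k + 2) / ((k + 2).factorial : ℝ)) := by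
          rw [mul_pow]; ring
      _ ≤ b ^ (k + 2) * Real.exp 1 ^ (k + 2) := by
          rw [← h2]; gcongr
      _ = a ^ (k + 2) := by rw [ha, mul_pow]; ring
  simp_rw [hpt]
  rw [lintegral_add_left measurable_const, lintegral_tsum fun k => by fun_prop]
  calc _ ≤ 1 + ∑' k : ℕ, ENNReal.ofReal (a ^ (k + 2)) := by
        simp only [lintegral_const, measure_univ, mul_one]
        gcongr with k
        exact hterm k
    _ = ENNReal.ofReal (1 + a ^ 2 / (1 - a)) := by
        rw [← ENNReal.ofReal_tsum_of_nonneg (fun k => by positivity) hgeo.summable, hgeo.tsum_eq,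
          ENNReal.ofReal_add zero_le_one (hgeo.nonneg fun k => by positivity), ENNReal.ofReal_one]
    _ ≤ _ := by
        apply ENNReal.ofReal_le_ofReal
        linarith [Real.add_one_le_exp (a ^ 2 / (1 - a))]

/-! ### Lipschitz functions of a vector with sub-exponential norm. -/

section Lipschitz

variable {E : Type*} [NormedAddCommGroup E]

theorem abs_sub_le_of_sub_le {f : E → ℝ} {c : ℝ} (hf : ∀ x y, f x - f y ≤ c * ‖x - y‖) (x y : E) :
    |f x - f y| ≤ c * ‖x - y‖ :=
  abs_sub_le_iff.2 ⟨hf x y, norm_sub_rev x y ▸ hf y x⟩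

theorem continuous_of_sub_le_mul_norm {f : E → ℝ} {c : ℝ} (hc : 0 ≤ c)
    (hf : ∀ x y, f x - f y ≤ c * ‖x - y‖) : Continuous f := by
  refine (LipschitzWith.of_dist_le_mul (K := c.toNNReal) fun x y => ?_).continuous
  rw [Real.dist_eq, dist_eq_norm, Real.coe_toNNReal _ hc]
  exact abs_sub_le_of_sub_le hf x y

theorem abs_sub_le_of_sub_le_sum {n : ℕ} {f : (Fin n → E) → ℝ} {c : ℝ}
    (hf : ∀ x y, f x - f y ≤ c * ∑ i, ‖x i - y i‖) (x y : Fin n → E) :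
    |f x - f y| ≤ c * ∑ i, ‖x i - y i‖ := by
  refine abs_sub_le_iff.2 ⟨hf x y, ?_⟩
  simp_rw [norm_sub_rev (x _)]
  exact hf y x

theorem continuous_of_sub_le_mul_sum {n : ℕ} {f : (Fin n → E) → ℝ} {c : ℝ} (hc : 0 ≤ c)
    (hf : ∀ x y, f x - f y ≤ c * ∑ i, ‖x i - y i‖) : Continuous f := by
  refine continuous_of_sub_le_mul_norm (c := c * n) (by positivity) fun x y => ?_
  refine (hf x y).trans ?_
  rw [mul_assoc]
  gcongr
  calc ∑ i, ‖x i - y i‖ ≤ ∑ _i : Fin n, ‖x - y‖ :=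
        Finset.sum_le_sum fun i _ => norm_le_pi_norm (x - y) i
    _ = n * ‖x - y‖ := by simp

variable [MeasurableSpace E] [BorelSpace E] {ν : Measure E}
  [IsProbabilityMeasure ν]

theorem integrable_of_sub_le_mul_norm (hν : Integrable (fun x : E => ‖x‖) ν) {f : E → ℝ} {c : ℝ}
    (hc : 0 ≤ c) (hf : ∀ x y, f x - f y ≤ c * ‖x - y‖) : Integrable f ν := by
  refine ((integrable_const |f 0|).add (hν.const_mul c)).mono'
    (continuous_of_sub_le_mul_norm hc hf).aestronglyMeasurable (ae_of_all _ fun x => ?_)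
  have := abs_sub_le_of_sub_le hf x 0
  rw [sub_zero] at this
  have h2 := abs_add_le (f 0) (f x - f 0)
  rw [add_sub_cancel] at h2
  simp only [Real.norm_eq_abs, Pi.add_apply]
  linarith

variable [SecondCountableTopology E]

theorem integrable_of_sub_le_mul_sum {n : ℕ} (hν : Integrable (fun x : E => ‖x‖) ν)
    {f : (Fin n → E) → ℝ} {c : ℝ} (hc : 0 ≤ c) (hf : ∀ x y, f x - f y ≤ c * ∑ i, ‖x i - y i‖) :
    Integrable f (Measure.pi fun _ => ν) := by
  have hs : Integrable (fun x : Fin n → E => ∑ i, ‖x i‖) (Measure.pi fun _ => ν) :=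
    integrable_finsetSum _ fun i _ => integrable_comp_eval (μ := fun _ => ν) hν
  refine ((integrable_const |f 0|).add (hs.const_mul c)).mono'
    (continuous_of_sub_le_mul_sum hc hf).measurable.aestronglyMeasurable
    (ae_of_all _ fun x => ?_)
  have := abs_sub_le_of_sub_le_sum hf x 0
  simp only [Pi.zero_apply, sub_zero] at this
  have h2 := abs_add_le (f 0) (f x - f 0)
  rw [add_sub_cancel] at h2
  simp only [Real.norm_eq_abs, Pi.add_apply]
  linarith

/-- Bernstein-type bound on the moment generating function of a Lipschitz function of a random
vector with sub-exponential norm. -/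
theorem lintegral_exp_lipschitz_le {K : ℝ} (hK : 0 ≤ K)
    (hint : ∀ k : ℕ, 1 ≤ k → Integrable (fun x : E => ‖x‖ ^ k) ν)
    (hmom : ∀ k : ℕ, 1 ≤ k → ∫ x, ‖x‖ ^ k ∂ν ≤ (K * k) ^ k)
    {f : E → ℝ} {c l : ℝ} (hc : 0 ≤ c) (hl : 0 ≤ l)
    (hf : ∀ x y, f x - f y ≤ c * ‖x - y‖) (ha : Real.exp 1 * (2 * (l * c) * K) < 1) :
    ∫⁻ x, ENNReal.ofReal (Real.exp (l * (f x - ∫ y, f y ∂ν))) ∂ν ≤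
      ENNReal.ofReal (Real.exp ((Real.exp 1 * (2 * (l * c) * K)) ^ 2 /
        (1 - Real.exp 1 * (2 * (l * c) * K)))) := by
  have hint1 : Integrable (fun x : E => ‖x‖) ν := by simpa using hint 1 le_rfl
  set m := ∫ x, ‖x‖ ∂ν with hm
  have hm0 : 0 ≤ m := integral_nonneg fun x => norm_nonneg x
  have hmK : m ≤ K := by simpa using hmom 1 le_rfl
  have hfi := integrable_of_sub_le_mul_norm hint1 hc hf
  -- `W` will dominate `l |f - E f|`, since `f x - E f` is the mean over `y` of `f x - f y`, and `‖x
  -- - y‖ ≤ ‖x‖ + ‖y‖`.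
  set W : E → ℝ := fun x => (l * c) * (‖x‖ + m) with hWdef
  have hW0 : ∀ x, 0 ≤ W x := fun x => by positivity
  have hWm : Measurable W := by fun_prop
  have hdom : ∀ (k : ℕ) (x : E),
      W x ^ k ≤ (l * c) ^ k * (2 ^ (k - 1) * (‖x‖ ^ k + m ^ k)) := fun k x => by
    rw [hWdef, mul_pow]
    gcongr
    exact add_pow_le (norm_nonneg x) hm0 k
  have hdomi : ∀ k : ℕ, 1 ≤ k → Integrable
      (fun x : E => (l * c) ^ k * (2 ^ (k - 1) * (‖x‖ ^ k + m ^ k))) ν := fun k hk =>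
    (((hint k hk).add (integrable_const _)).const_mul _).const_mul _
  have hWi : ∀ k : ℕ, 1 ≤ k → Integrable (fun x => W x ^ k) ν := fun k hk =>
    (hdomi k hk).mono' (by fun_prop) (ae_of_all _ fun x => by
      rw [Real.norm_of_nonneg (pow_nonneg (hW0 x) k)]; exact hdom k x)
  have hWmom : ∀ k : ℕ, 1 ≤ k → ∫ x, W x ^ k ∂ν ≤ (2 * (l * c) * K * k) ^ k := fun k hk => by
    have hk1 : (1 : ℝ) ≤ k := by exact_mod_cast hk
    calc ∫ x, W x ^ k ∂ν ≤ ∫ x, (l * c) ^ k * (2 ^ (k - 1) * (‖x‖ ^ k + m ^ k)) ∂ν :=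
          integral_mono (hWi k hk) (hdomi k hk) (hdom k)
      _ = (l * c) ^ k * (2 ^ (k - 1) * ((∫ x, ‖x‖ ^ k ∂ν) + m ^ k)) := by
          rw [integral_const_mul, integral_const_mul, integral_add (hint k hk) (integrable_const _)]
          simp
      -- The two equal summands restore the factor lost in `2 ^ (k - 1)`, so the moment parameter
      -- becomes exactly `2 l c K`.
      _ ≤ (l * c) ^ k * (2 ^ (k - 1) * ((K * k) ^ k + (K * k) ^ k)) := by
          gcongr
          · exact hmom k hk
          · nlinarith
      _ = (2 * (l * c) * K * k) ^ k := by
          obtain ⟨j, rfl⟩ : ∃ j, k = j + 1 := ⟨k - 1, by omega⟩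
          simp only [Nat.add_sub_cancel, mul_pow, pow_succ (2 : ℝ)]
          ring
  have hB := lintegral_exp_sub_self_le hWm hW0 (b := 2 * (l * c) * K) (by positivity) hWi hWmom ha
  have hnn : ∀ x, 0 ≤ Real.exp (W x) - W x := fun x => by
    linarith [Real.add_one_le_exp (W x)]
  have hVi : Integrable (fun x => Real.exp (W x) - W x) ν := by
    refine ⟨by fun_prop, ?_⟩
    rw [hasFiniteIntegral_iff_ofReal (ae_of_all _ hnn)]
    exact hB.trans_lt ENNReal.ofReal_lt_top
  set I := ∫ y, f y ∂ν with hI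
  have habs : ∀ x, |l * (f x - I)| ≤ W x := fun x => by
    rw [abs_mul, abs_of_nonneg hl]
    change _ ≤ l * c * (‖x‖ + m)
    rw [mul_assoc]
    gcongr
    have e1 : f x - I = ∫ y, (f x - f y) ∂ν := by
      rw [integral_sub (integrable_const _) hfi]; simp [hI]
    rw [e1]
    calc |∫ y, (f x - f y) ∂ν| ≤ ∫ y, |f x - f y| ∂ν := abs_integral_le_integral_abs
      _ ≤ ∫ y, c * (‖x‖ + ‖y‖) ∂ν := by
          refine integral_mono ((integrable_const _).sub hfi).abs
            (((integrable_const _).add hint1).const_mul c) fun y => ?_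
          exact (abs_sub_le_of_sub_le hf x y).trans (by gcongr; exact norm_sub_le x y)
      _ = c * (‖x‖ + m) := by
          rw [integral_const_mul, integral_add (integrable_const _) hint1]; simp [hm]
  have hui : Integrable (fun x => l * (f x - I)) ν := (hfi.sub (integrable_const _)).const_mul l
  have hu0 : ∫ x, l * (f x - I) ∂ν = 0 := by
    rw [integral_const_mul, integral_sub hfi (integrable_const _)]; simp [hI]
  have hle : ∀ x, Real.exp (l * (f x - I)) ≤ (Real.exp (W x) - W x) + l * (f x - I) := fun x =>
    (exp_le_exp_abs_sub_abs_add _).trans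
      (by gcongr ?_ + _; exact exp_sub_self_mono (abs_nonneg _) (habs x))
  calc ∫⁻ x, ENNReal.ofReal (Real.exp (l * (f x - I))) ∂ν
      ≤ ∫⁻ x, ENNReal.ofReal ((Real.exp (W x) - W x) + l * (f x - I)) ∂ν := by
        gcongr with x; exact hle x
    _ = ENNReal.ofReal (∫ x, (Real.exp (W x) - W x) + l * (f x - I) ∂ν) :=
        (ofReal_integral_eq_lintegral_ofReal (hVi.add hui)
          (ae_of_all _ fun x => (Real.exp_pos _).le.trans (hle x))).symm
    _ = ENNReal.ofReal (∫ x, (Real.exp (W x) - W x) ∂ν) := by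
        rw [integral_add hVi hui, hu0, add_zero]
    _ = ∫⁻ x, ENNReal.ofReal (Real.exp (W x) - W x) ∂ν :=
        ofReal_integral_eq_lintegral_ofReal hVi (ae_of_all _ hnn)
    _ ≤ _ := hB

end Lipschitz

/-! ### Tensorization and the Bernstein tail bound. -/

section Tensorization

theorem measurePreserving_cons {E : Type*} [MeasurableSpace E] (ν : Measure E) [IsProbabilityMeasure ν] (n : ℕ) :
    MeasurePreserving (fun p : E × (Fin n → E) => (Fin.cons p.1 p.2 : Fin (n + 1) → E))
      (ν.prod (Measure.pi fun _ : Fin n => ν)) (Measure.pi fun _ : Fin (n + 1) => ν) := by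
  have h := (measurePreserving_piFinSuccAbove (fun _ : Fin (n + 1) => ν) 0).symm
  convert h using 1
  funext p
  exact (Fin.insertNth_zero (α := fun _ => E) p.1 p.2).symm

variable {E : Type*} [NormedAddCommGroup E] [MeasurableSpace E] [BorelSpace E]
  [SecondCountableTopology E] {ν : Measure E} [IsProbabilityMeasure ν]

/-- Tensorization of a bound on moment generating functions of Lipschitz functions. -/
theorem lintegral_exp_pi_le {c l B : ℝ} (hc : 0 ≤ c)
    (hν : Integrable (fun x : E => ‖x‖) ν)
    (hone : ∀ f : E → ℝ, (∀ x y, f x - f y ≤ c * ‖x - y‖) →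
      ∫⁻ x, ENNReal.ofReal (Real.exp (l * (f x - ∫ y, f y ∂ν))) ∂ν ≤ ENNReal.ofReal (Real.exp B)) :
    ∀ (n : ℕ) (f : (Fin n → E) → ℝ), (∀ x y, f x - f y ≤ c * ∑ i, ‖x i - y i‖) →
      ∫⁻ x, ENNReal.ofReal (Real.exp (l * (f x - ∫ y, f y ∂(Measure.pi fun _ => ν))))
        ∂(Measure.pi fun _ => ν) ≤ ENNReal.ofReal (Real.exp (n * B)) := by
  intro n
  induction n with
  | zero =>
    intro f _
    have : ∀ x, f x = f default := fun x => congrArg f (Subsingleton.elim _ _)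
    simp_rw [this]
    simp
  | succ n ih =>
    intro f hf
    have hmp := measurePreserving_cons ν n
    have hfc := continuous_of_sub_le_mul_sum hc hf
    have hfi := integrable_of_sub_le_mul_sum hν hc hf
    have hfi' : Integrable (fun p : E × (Fin n → E) => f (Fin.cons p.1 p.2))
        (ν.prod (Measure.pi fun _ : Fin n => ν)) := hmp.integrable_comp_of_integrable hfi
    have hsec : ∀ x0 x y, f (Fin.cons x0 x) - f (Fin.cons x0 y) ≤ c * ∑ i, ‖x i - y i‖ := by
      intro x0 x y
      simpa [Fin.sum_univ_succ] using hf (Fin.cons x0 x) (Fin.cons x0 y)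
    have hseci : ∀ x0, Integrable (fun x => f (Fin.cons x0 x)) (Measure.pi fun _ : Fin n => ν) :=
      fun x0 => integrable_of_sub_le_mul_sum hν hc (hsec x0)
    -- Averaging over the last `n` coordinates keeps the constant `c` in the first one, so the
    -- one-variable bound applies to `g` and the induction hypothesis to each section of `f`.
    set g : E → ℝ := fun x0 => ∫ x, f (Fin.cons x0 x) ∂(Measure.pi fun _ : Fin n => ν) with hg
    have hgl : ∀ x y, g x - g y ≤ c * ‖x - y‖ := by
      intro x y
      rw [hg, ← integral_sub (hseci x) (hseci y)]
      calc _ ≤ ∫ _z, c * ‖x - y‖ ∂(Measure.pi fun _ : Fin n => ν) := by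
            refine integral_mono ((hseci x).sub (hseci y)) (integrable_const _) fun z => ?_
            simpa [Fin.sum_univ_succ] using hf (Fin.cons x z) (Fin.cons y z)
        _ = c * ‖x - y‖ := by simp
    have hgc := continuous_of_sub_le_mul_norm hc hgl
    have hmean : ∫ y, f y ∂(Measure.pi fun _ => ν) = ∫ x, g x ∂ν := by
      rw [← hmp.map_eq, integral_map hmp.measurable.aemeasurable
        hfc.measurable.aestronglyMeasurable, integral_prod _ hfi']
    have hfm : Measurable fun p : E × (Fin n → E) => f (Fin.cons p.1 p.2) :=
      hfc.measurable.comp hmp.measurable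
    rw [hmean]
    set I := ∫ x, g x ∂ν
    rw [← hmp.map_eq, lintegral_map (by fun_prop) hmp.measurable,
      lintegral_prod _ (by fun_prop)]
    calc ∫⁻ x, ∫⁻ y, ENNReal.ofReal (Real.exp (l * (f (Fin.cons x y) - I)))
          ∂(Measure.pi fun _ : Fin n => ν) ∂ν
        = ∫⁻ x, ENNReal.ofReal (Real.exp (l * (g x - I))) *
            ∫⁻ y, ENNReal.ofReal (Real.exp (l * (f (Fin.cons x y) - g x)))
              ∂(Measure.pi fun _ : Fin n => ν) ∂ν := by
          refine lintegral_congr fun x => ?_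
          have : Measurable fun y : Fin n → E => f (Fin.cons x y) :=
            hfm.comp measurable_prodMk_left
          rw [← lintegral_const_mul _ (by fun_prop)]
          refine lintegral_congr fun y => ?_
          rw [← ENNReal.ofReal_mul (Real.exp_pos _).le, ← Real.exp_add]
          congr 2
          ring
      _ ≤ ∫⁻ x, ENNReal.ofReal (Real.exp (l * (g x - I))) * ENNReal.ofReal (Real.exp (n * B)) ∂ν := by
          gcongr with x
          exact ih _ (hsec x)
      _ ≤ ENNReal.ofReal (Real.exp B) * ENNReal.ofReal (Real.exp (n * B)) := by
          rw [lintegral_mul_const _ (by fun_prop)]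
          gcongr
          exact hone g hgl
      _ = ENNReal.ofReal (Real.exp ((n + 1 : ℕ) * B)) := by
          rw [← ENNReal.ofReal_mul (Real.exp_pos _).le, ← Real.exp_add]
          congr 2
          push_cast
          ring

/-- Concentration for Lipschitz functions of independent vectors with sub-exponential norms. -/
theorem measure_sub_integral_le_ge {K : ℝ} (hK : 0 < K)
    (hint : ∀ k : ℕ, 1 ≤ k → Integrable (fun x : E => ‖x‖ ^ k) ν)
    (hmom : ∀ k : ℕ, 1 ≤ k → ∫ x, ‖x‖ ^ k ∂ν ≤ (K * k) ^ k) {n : ℕ} (hn : n ≠ 0)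
    {L : ℝ} (hL : 0 < L) {f : (Fin n → E) → ℝ}
    (hf : ∀ x y, f x - f y ≤ L / n * ∑ i, ‖x i - y i‖) {u : ℝ} (hu : 0 < u) (hun : u ≤ n) :
    ENNReal.ofReal (1 - Real.exp (-u)) ≤ (Measure.pi fun _ : Fin n => ν)
      {x | f x ≤ (∫ y, f y ∂(Measure.pi fun _ => ν)) +
        12 * Real.exp 1 * L * √(u / n) * K} := by
  have hn0 : (0 : ℝ) < n := by positivity
  set s := √(u / n) with hs
  have hs0 : 0 < s := Real.sqrt_pos.2 (by positivity)
  have hs1 : s ≤ 1 := Real.sqrt_le_one.2 ((div_le_one hn0).2 hun)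
  have hsq : n * s ^ 2 = u := by
    rw [hs, Real.sq_sqrt (by positivity)]; field_simp
  have hc : 0 ≤ L / n := by positivity
  -- With this `l` the series parameter is `s / 2 ≤ 1 / 2`, so the geometric denominator costs at
  -- most a factor `2` and the log-moment bound is at most `u / 2`. Since `l t = 3 u`, the final
  -- exponent is `-5 u / 2`, with room to spare below `-u`.
  set l := s * n / (4 * Real.exp 1 * K * L) with hl
  have he : 0 < Real.exp 1 := Real.exp_pos 1
  have hl0 : 0 < l := by positivity
  have ha : Real.exp 1 * (2 * (l * (L / n)) * K) = s / 2 := by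
    rw [hl]; field_simp; norm_num
  have hfc := continuous_of_sub_le_mul_sum hc hf
  have hmgf := lintegral_exp_pi_le hc (by simpa using hint 1 le_rfl)
    (fun g hg => lintegral_exp_lipschitz_le hK.le hint hmom hc hl0.le hg (by rw [ha]; linarith)) n f hf
  rw [ha] at hmgf
  set I := ∫ y, f y ∂(Measure.pi fun _ => ν)
  set t := 12 * Real.exp 1 * L * s * K with ht
  have hlt : l * t = 3 * u := by
    rw [hl, ht, ← hsq]; field_simp; norm_num
  have hexp : n * ((s / 2) ^ 2 / (1 - s / 2)) ≤ u / 2 := by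
    have : (s / 2) ^ 2 / (1 - s / 2) ≤ s ^ 2 / 2 := by
      rw [div_le_iff₀ (by linarith)]; nlinarith [sq_nonneg s]
    calc _ ≤ n * (s ^ 2 / 2) := by gcongr
      _ = u / 2 := by rw [← hsq]; ring
  have hmeas : Measurable fun x => ENNReal.ofReal (Real.exp (l * (f x - I))) := by
    have := hfc.measurable
    fun_prop
  have htail : (Measure.pi fun _ : Fin n => ν) {x | f x ≤ I + t}ᶜ ≤
      ENNReal.ofReal (Real.exp (-u)) := by
    calc (Measure.pi fun _ : Fin n => ν) {x | f x ≤ I + t}ᶜ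
        ≤ (Measure.pi fun _ : Fin n => ν) {x | ENNReal.ofReal (Real.exp (l * t)) ≤
            ENNReal.ofReal (Real.exp (l * (f x - I)))} := by
          refine measure_mono fun x hx => ?_
          simp only [Set.mem_compl_iff, Set.mem_ofPred_eq, not_le] at hx ⊢
          apply ENNReal.ofReal_le_ofReal
          gcongr
          linarith
      _ ≤ _ := meas_ge_le_lintegral_div hmeas.aemeasurable
            (by simp [Real.exp_pos]) ENNReal.ofReal_ne_top
      _ ≤ ENNReal.ofReal (Real.exp (u / 2)) / ENNReal.ofReal (Real.exp (l * t)) := by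
          gcongr
          exact hmgf.trans (ENNReal.ofReal_le_ofReal (Real.exp_le_exp.2 hexp))
      _ = ENNReal.ofReal (Real.exp (u / 2 - 3 * u)) := by
          rw [← ENNReal.ofReal_div_of_pos (Real.exp_pos _), ← Real.exp_sub, hlt]
      _ ≤ _ := by
          apply ENNReal.ofReal_le_ofReal
          gcongr
          linarith
  have hms : MeasurableSet {x | f x ≤ I + t} := measurableSet_le hfc.measurable measurable_const
  rw [← compl_compl {x | f x ≤ I + t}, prob_compl_eq_one_sub hms.compl,
    ENNReal.ofReal_sub _ (Real.exp_pos _).le, ENNReal.ofReal_one]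
  gcongr

end Tensorization

/-! ### Uniform deviations and symmetrization. -/

section Symmetrization

theorem integral_comp_of_measurePreserving {α β : Type*} [MeasurableSpace α] [MeasurableSpace β]
    {μ : Measure α} {ν : Measure β} {f : α → β} (hf : MeasurePreserving f μ ν) {g : β → ℝ}
    (hg : AEStronglyMeasurable g ν) : ∫ x, g (f x) ∂μ = ∫ y, g y ∂ν := by
  rw [← hf.map_eq] at hg ⊢
  exact (integral_map hf.measurable.aemeasurable hg).symm

theorem ciSup_sub_ciSup_le {ι : Type*} [Nonempty ι] {a b : ι → ℝ} {d : ℝ}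
    (hb : BddAbove (Set.range b)) (h : ∀ i, a i ≤ b i + d) : (⨆ i, a i) - ⨆ i, b i ≤ d :=
  sub_le_iff_le_add.2 (ciSup_le fun i => (h i).trans (by
    rw [add_comm]; gcongr; exact le_ciSup hb i))

/-- The supremum over a class `h` of the sums weighted by the signs `ε` at the sample `x`. -/
noncomputable def signedSup {ι E : Type*} {n : ℕ} (h : ι → E → ℝ) (ε : Fin n → ℤˣ) (x : Fin n → E) : ℝ :=
  ⨆ i, ∑ j, ((ε j : ℤ) : ℝ) * h i (x j)

/-- The largest deviation of empirical means from means over a class `h`. -/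
noncomputable def supDeviation {ι E : Type*} [MeasurableSpace E] {n : ℕ} (h : ι → E → ℝ) (ν : Measure E)
    (x : Fin n → E) : ℝ :=
  ⨆ i, (1 / (n : ℝ) * ∑ j, h i (x j) - ∫ y, h i y ∂ν)

theorem sign_mul_le_abs (e : ℤˣ) (a : ℝ) : ((e : ℤ) : ℝ) * a ≤ |a| := by
  rcases Int.units_eq_one_or e with rfl | rfl
  · simpa using le_abs_self a
  · simpa using neg_le_abs a

variable {ι : Type*} [Nonempty ι] {E : Type*} [NormedAddCommGroup E] {h : ι → E → ℝ} {L M : ℝ}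

-- The bound at `0` and the common Lipschitz constant control the whole class at each point. Without
-- this the real-valued `⨆` could be the default value `0`.
omit [Nonempty ι] in
theorem bddAbove_signedSup (hL : ∀ i x y, h i x - h i y ≤ L * ‖x - y‖)
    (hM : ∀ i, |h i 0| ≤ M) {n : ℕ} (ε : Fin n → ℤˣ) (x : Fin n → E) :
    BddAbove (Set.range fun i => ∑ j, ((ε j : ℤ) : ℝ) * h i (x j)) := by
  refine ⟨∑ j, (M + L * ‖x j‖), ?_⟩
  rintro _ ⟨i, rfl⟩
  refine Finset.sum_le_sum fun j _ => (sign_mul_le_abs _ _).trans ?_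
  have := abs_sub_le_of_sub_le (hL i) (x j) 0
  rw [sub_zero] at this
  have h2 := abs_add_le (h i 0) (h i (x j) - h i 0)
  rw [add_sub_cancel] at h2
  linarith [hM i]

theorem signedSup_sub_le (hL : ∀ i x y, h i x - h i y ≤ L * ‖x - y‖)
    (hM : ∀ i, |h i 0| ≤ M) {n : ℕ} (ε : Fin n → ℤˣ) (x y : Fin n → E) :
    signedSup h ε x - signedSup h ε y ≤ L * ∑ j, ‖x j - y j‖ := by
  refine ciSup_sub_ciSup_le (bddAbove_signedSup hL hM ε y) fun i => ?_
  rw [← sub_le_iff_le_add', ← Finset.sum_sub_distrib, Finset.mul_sum]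
  refine Finset.sum_le_sum fun j _ => ?_
  rw [← mul_sub]
  exact (sign_mul_le_abs _ _).trans (abs_sub_le_of_sub_le (hL i) _ _)

/-- The ghost half of each difference carries the opposite sign, which is why `-ε` appears. -/
theorem signedSup_prod_le (hL : ∀ i x y, h i x - h i y ≤ L * ‖x - y‖)
    (hM : ∀ i, |h i 0| ≤ M) {n : ℕ} (ε : Fin n → ℤˣ) (z : Fin n → E × E) :
    signedSup (fun i (p : E × E) => h i p.1 - h i p.2) ε z ≤
      signedSup h ε (fun j => (z j).1) + signedSup h (-ε) (fun j => (z j).2) := by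
  refine ciSup_le fun i => ?_
  have h1 := le_ciSup (bddAbove_signedSup hL hM ε fun j => (z j).1) i
  have h2 := le_ciSup (bddAbove_signedSup hL hM (-ε) fun j => (z j).2) i
  refine le_trans (le_of_eq ?_) (add_le_add h1 h2)
  rw [← Finset.sum_add_distrib]
  refine Finset.sum_congr rfl fun j _ => ?_
  simp only [Pi.neg_apply, Units.val_neg, Int.cast_neg]
  ring

-- The constant `2 * L` serves only boundedness and integrability on the doubled space; it does not
-- enter the final bound.
omit [Nonempty ι] in
theorem prod_diff_sub_le (hL0 : 0 ≤ L) (hL : ∀ i x y, h i x - h i y ≤ L * ‖x - y‖) (i : ι)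
    (p q : E × E) : (h i p.1 - h i p.2) - (h i q.1 - h i q.2) ≤ 2 * L * ‖p - q‖ := by
  have h1 := hL i p.1 q.1
  have h2 := hL i q.2 p.2
  have h3 : L * ‖p.1 - q.1‖ ≤ L * ‖p - q‖ := by gcongr; exact norm_fst_le (p - q)
  have h4 : L * ‖q.2 - p.2‖ ≤ L * ‖p - q‖ := by
    rw [norm_sub_rev]; gcongr; exact norm_snd_le (p - q)
  linarith

variable [MeasurableSpace E] [BorelSpace E] {ν : Measure E} [IsProbabilityMeasure ν]

omit [Nonempty ι] in
theorem bddAbove_supDeviation (hL0 : 0 ≤ L) (hL : ∀ i x y, h i x - h i y ≤ L * ‖x - y‖)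
    (hM : ∀ i, |h i 0| ≤ M) (hν : Integrable (fun x : E => ‖x‖) ν) {n : ℕ} (x : Fin n → E) :
    BddAbove (Set.range fun i => 1 / (n : ℝ) * ∑ j, h i (x j) - ∫ y, h i y ∂ν) := by
  obtain ⟨B, hB⟩ := bddAbove_signedSup hL hM 1 x
  refine ⟨1 / n * B + (M + L * ∫ y, ‖y‖ ∂ν), ?_⟩
  rintro _ ⟨i, rfl⟩
  have h1 := hB ⟨i, rfl⟩
  simp only [Pi.one_apply, Units.val_one, Int.cast_one, one_mul] at h1
  have h2 : 1 / (n : ℝ) * ∑ j, h i (x j) ≤ 1 / n * B := by gcongr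
  have h3 : -∫ y, h i y ∂ν ≤ M + L * ∫ y, ‖y‖ ∂ν := by
    rw [← integral_neg]
    calc ∫ y, -h i y ∂ν ≤ ∫ y, (M + L * ‖y‖) ∂ν := by
          refine integral_mono (integrable_of_sub_le_mul_norm hν hL0 (hL i)).neg
            ((integrable_const _).add (hν.const_mul L)) fun y => ?_
          have := hL i 0 y
          rw [zero_sub, norm_neg] at this
          have h2 := neg_le_abs (h i 0)
          have h3 := hM i
          simp only
          linarith
      _ = _ := by
          rw [integral_add (integrable_const _) (hν.const_mul L), integral_const_mul]; simp
  simp only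
  linarith

theorem supDeviation_sub_le (hL0 : 0 ≤ L) (hL : ∀ i x y, h i x - h i y ≤ L * ‖x - y‖)
    (hM : ∀ i, |h i 0| ≤ M) (hν : Integrable (fun x : E => ‖x‖) ν) {n : ℕ} (x y : Fin n → E) :
    supDeviation h ν x - supDeviation h ν y ≤ L / n * ∑ j, ‖x j - y j‖ := by
  refine ciSup_sub_ciSup_le (bddAbove_supDeviation hL0 hL hM hν y) fun i => ?_
  have h1 : ∑ j, h i (x j) ≤ ∑ j, h i (y j) + L * ∑ j, ‖x j - y j‖ := by
    rw [← sub_le_iff_le_add', ← Finset.sum_sub_distrib, Finset.mul_sum]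
    exact Finset.sum_le_sum fun j _ => hL i _ _
  have h2 : 1 / (n : ℝ) * ∑ j, h i (x j) ≤
      1 / n * (∑ j, h i (y j) + L * ∑ j, ‖x j - y j‖) := by gcongr
  have h3 : L / (n : ℝ) * ∑ j, ‖x j - y j‖ = 1 / n * (L * ∑ j, ‖x j - y j‖) := by ring
  rw [h3]
  linarith

variable [SecondCountableTopology E]

theorem integrable_norm_prod (hν : Integrable (fun x : E => ‖x‖) ν) :
    Integrable (fun p : E × E => ‖p‖) (ν.prod ν) := by
  refine ((hν.comp_fst ν).add (hν.comp_snd ν)).mono' (by fun_prop) (ae_of_all _ fun p => ?_)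
  rw [norm_norm]
  exact max_le (le_add_of_nonneg_right (norm_nonneg _)) (le_add_of_nonneg_left (norm_nonneg _))

theorem integrable_signedSup (hL0 : 0 ≤ L) (hL : ∀ i x y, h i x - h i y ≤ L * ‖x - y‖)
    (hM : ∀ i, |h i 0| ≤ M) (hν : Integrable (fun x : E => ‖x‖) ν) {n : ℕ} (ε : Fin n → ℤˣ) :
    Integrable (signedSup h ε) (Measure.pi fun _ : Fin n => ν) :=
  integrable_of_sub_le_mul_sum hν hL0 (signedSup_sub_le hL hM ε)

/-- Replacing the mean by the mean of a ghost sample. -/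
theorem integral_supDeviation_le_ghost (hL0 : 0 ≤ L)
    (hL : ∀ i x y, h i x - h i y ≤ L * ‖x - y‖)
    (hM : ∀ i, |h i 0| ≤ M) (hν : Integrable (fun x : E => ‖x‖) ν) {n : ℕ} (hn : n ≠ 0) :
    n * ∫ x, supDeviation h ν x ∂(Measure.pi fun _ : Fin n => ν) ≤
      ∫ z, signedSup (fun i (p : E × E) => h i p.1 - h i p.2) 1 z
        ∂(Measure.pi fun _ : Fin n => ν.prod ν) := by
  have hn0 : (n : ℝ) ≠ 0 := by exact_mod_cast hn
  set h' : ι → E × E → ℝ := fun i p => h i p.1 - h i p.2 with hh'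
  have hL' := prod_diff_sub_le hL0 hL
  have hM' : ∀ i, |h' i 0| ≤ 0 := fun i => by simp [hh']
  have h2L : 0 ≤ 2 * L := by positivity
  have hSi := integrable_signedSup h2L hL' hM' (integrable_norm_prod hν) (1 : Fin n → ℤˣ)
  have hmp := measurePreserving_arrowProdEquivProdArrow E E (Fin n) (fun _ => ν) (fun _ => ν)
  set e := MeasurableEquiv.arrowProdEquivProdArrow E E (Fin n)
  have hSi' : Integrable (fun p => signedSup h' 1 (e.symm p))
      ((Measure.pi fun _ : Fin n => ν).prod (Measure.pi fun _ : Fin n => ν)) :=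
    hmp.symm.integrable_comp_of_integrable hSi
  -- Separate the sample `x` from the ghost sample `y` by Fubini. For fixed `x`, each deviation is a
  -- mean over `y` of a member of the signed family, and a supremum of means is at most the mean of
  -- the supremum.
  rw [← hmp.symm.integral_comp' (signedSup h' 1), integral_prod _ hSi', ← integral_const_mul]
  refine integral_mono ((integrable_of_sub_le_mul_sum hν (by positivity)
    (supDeviation_sub_le hL0 hL hM hν)).const_mul _) hSi'.integral_prod_left fun x => ?_
  have hsec : Integrable (fun y => signedSup h' 1 (e.symm (x, y)))
      (Measure.pi fun _ : Fin n => ν) := by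
    refine integrable_of_sub_le_mul_sum hν h2L fun y y' => ?_
    refine (signedSup_sub_le hL' hM' 1 _ _).trans (le_of_eq ?_)
    congr 1
    refine Finset.sum_congr rfl fun j _ => ?_
    change ‖((x j, y j) : E × E) - (x j, y' j)‖ = _
    simp [Prod.norm_def]
  have hn1 : 0 ≤ (n : ℝ) := Nat.cast_nonneg n
  simp only
  rw [supDeviation, Real.mul_iSup_of_nonneg hn1]
  refine ciSup_le fun i => ?_
  have hii : ∀ j : Fin n, Integrable (fun y : Fin n → E => h i (y j))
      (Measure.pi fun _ : Fin n => ν) := fun j =>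
    integrable_comp_eval (μ := fun _ => ν) (integrable_of_sub_le_mul_norm hν hL0 (hL i))
  have hij : ∀ j : Fin n, ∫ y : Fin n → E, h i (y j) ∂(Measure.pi fun _ : Fin n => ν) =
      ∫ y, h i y ∂ν := fun j => 
    integral_comp_of_measurePreserving (measurePreserving_eval (fun _ : Fin n => ν) j)
      (continuous_of_sub_le_mul_norm hL0 (hL i)).aestronglyMeasurable
  calc (n : ℝ) * (1 / n * ∑ j, h i (x j) - ∫ y, h i y ∂ν)
      = ∫ y : Fin n → E, ∑ j, (h i (x j) - h i (y j)) ∂(Measure.pi fun _ : Fin n => ν) := by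
        rw [integral_finsetSum]
        swap
        · exact fun j _ => (integrable_const _).sub (hii j)
        simp_rw [integral_sub (integrable_const _) (hii _), hij]
        simp
        field_simp
    _ ≤ _ := by
        refine integral_mono (integrable_finsetSum _ fun j _ => (integrable_const _).sub (hii j))
          hsec fun y => ?_
        refine le_trans (le_of_eq ?_) (le_ciSup (bddAbove_signedSup hL' hM' 1 _) i)
        refine Finset.sum_congr rfl fun j _ => ?_
        simp only [Pi.one_apply, Units.val_one, Int.cast_one, one_mul]
        rfl

omit [Nonempty ι] [BorelSpace E] in
/-- Exchanging sample points with ghost sample points introduces signs. -/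
theorem integral_signedSup_prod_eq {n : ℕ} (ε : Fin n → ℤˣ) :
    ∫ z, signedSup (fun i (p : E × E) => h i p.1 - h i p.2) 1 z
        ∂(Measure.pi fun _ : Fin n => ν.prod ν) =
      ∫ z, signedSup (fun i (p : E × E) => h i p.1 - h i p.2) ε z
        ∂(Measure.pi fun _ : Fin n => ν.prod ν) := by
  -- Swap the pair exactly where `ε j = -1`. Both halves have law `ν`, so the swap preserves `ν.prod
  -- ν` and flips the sign of the difference.
  set e : ∀ _ : Fin n, E × E ≃ᵐ E × E := fun j =>
    if ε j = 1 then MeasurableEquiv.refl _ else MeasurableEquiv.prodComm with he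
  have hmp : MeasurePreserving (MeasurableEquiv.piCongrRight e)
      (Measure.pi fun _ : Fin n => ν.prod ν) (Measure.pi fun _ : Fin n => ν.prod ν) := by
    refine measurePreserving_pi (fun _ => ν.prod ν) (fun _ => ν.prod ν) fun j => ?_
    rw [he]
    by_cases hj : ε j = 1
    · simp only [hj, if_true]
      exact MeasurePreserving.id _
    · simp only [hj, if_false]
      exact Measure.measurePreserving_swap
  rw [← hmp.integral_comp' (signedSup _ 1)]
  congr 1
  funext z
  rw [signedSup, signedSup]
  congr 1
  funext i
  refine Finset.sum_congr rfl fun j _ => ?_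
  change ((1 : ℤ) : ℝ) * (h i ((e j) (z j)).1 - h i ((e j) (z j)).2) = _
  rcases Int.units_eq_one_or (ε j) with hj | hj
  · have : e j = MeasurableEquiv.refl _ := by rw [he]; simp only [hj, if_true]
    simp [this, hj]
  · have : e j = MeasurableEquiv.prodComm := by
      rw [he]; simp only [hj]; rw [if_neg (by decide)]
    have h2 : (MeasurableEquiv.prodComm (z j)) = (z j).swap := rfl
    simp [this, hj, h2]

/-- Symmetrization. -/
theorem integral_supDeviation_le (hL0 : 0 ≤ L) (hL : ∀ i x y, h i x - h i y ≤ L * ‖x - y‖)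
    (hM : ∀ i, |h i 0| ≤ M) (hν : Integrable (fun x : E => ‖x‖) ν) {n : ℕ} (hn : n ≠ 0) :
    ∫ x, supDeviation h ν x ∂(Measure.pi fun _ : Fin n => ν) ≤
      ∫ x, 2 / (n : ℝ) * (1 / 2 ^ n) * ∑ ε : Fin n → ℤˣ, signedSup h ε x
        ∂(Measure.pi fun _ : Fin n => ν) := by
  have hn0 : (0 : ℝ) < n := by positivity
  set h' : ι → E × E → ℝ := fun i p => h i p.1 - h i p.2 with hh'
  have hM' : ∀ i, |h' i 0| ≤ 0 := fun i => by simp [hh']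
  have hi := fun ε : Fin n → ℤˣ => integrable_signedSup hL0 hL hM hν ε
  set A : (Fin n → ℤˣ) → ℝ := fun ε => ∫ x, signedSup h ε x ∂(Measure.pi fun _ : Fin n => ν)
    with hA
  set J := ∫ z, signedSup h' 1 z ∂(Measure.pi fun _ : Fin n => ν.prod ν) with hJ
  have hfst : MeasurePreserving (fun (z : Fin n → E × E) j => (z j).1)
      (Measure.pi fun _ : Fin n => ν.prod ν) (Measure.pi fun _ : Fin n => ν) :=
    measurePreserving_pi (fun _ => ν.prod ν) (fun _ => ν) fun _ => measurePreserving_fst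
  have hsnd : MeasurePreserving (fun (z : Fin n → E × E) j => (z j).2)
      (Measure.pi fun _ : Fin n => ν.prod ν) (Measure.pi fun _ : Fin n => ν) :=
    measurePreserving_pi (fun _ => ν.prod ν) (fun _ => ν) fun _ => measurePreserving_snd
  have hpair : ∀ ε, J ≤ A ε + A (-ε) := fun ε => by
    rw [hJ, integral_signedSup_prod_eq ε]
    have i1 := hfst.integrable_comp_of_integrable (hi ε)
    have i2 := hsnd.integrable_comp_of_integrable (hi (-ε))
    have e1 : A ε = ∫ z, signedSup h ε (fun j => (z j).1)
        ∂(Measure.pi fun _ : Fin n => ν.prod ν) :=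
      (integral_comp_of_measurePreserving hfst (hi ε).1).symm
    have e2 : A (-ε) = ∫ z, signedSup h (-ε) (fun j => (z j).2)
        ∂(Measure.pi fun _ : Fin n => ν.prod ν) :=
      (integral_comp_of_measurePreserving hsnd (hi (-ε)).1).symm
    rw [e1, e2]
    refine le_trans ?_ (integral_add i1 i2).le
    exact integral_mono (integrable_signedSup (by positivity) (prod_diff_sub_le hL0 hL) hM'
      (integrable_norm_prod hν) ε) (i1.add i2) fun z => signedSup_prod_le hL hM ε z
  -- Sum over all `2 ^ n` sign vectors. Since `ε ↦ -ε` permutes them, both halves contribute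
  -- equally, whence the factor `2` in the complexity.
  have hsum : 2 ^ n * J ≤ 2 * ∑ ε, A ε := by
    have h1 := Finset.sum_le_sum fun ε (_ : ε ∈ Finset.univ) => hpair ε
    have h2 : ∑ ε, A (-ε) = ∑ ε, A ε := Equiv.sum_comp (Equiv.neg (Fin n → ℤˣ)) A
    rw [Finset.sum_add_distrib, h2] at h1
    simp only [Finset.sum_const, Finset.card_univ, Fintype.card_pi, Fintype.card_units_int,
      Finset.prod_const, Fintype.card_fin, nsmul_eq_mul, Nat.cast_pow, Nat.cast_ofNat] at h1
    linarith
  have hg := integral_supDeviation_le_ghost hL0 hL hM hν hn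
  rw [integral_const_mul, integral_finsetSum _ fun ε _ => hi ε]
  have h3 : 2 / (n : ℝ) * (1 / 2 ^ n) * ∑ ε, A ε = (2 * ∑ ε, A ε) / (n * 2 ^ n) := by
    field_simp
  change _ ≤ 2 / (n : ℝ) * (1 / 2 ^ n) * ∑ ε, A ε
  rw [h3, le_div_iff₀ (by positivity)]
  calc _ = 2 ^ n * (n * ∫ x, supDeviation h ν x ∂(Measure.pi fun _ : Fin n => ν)) := by ring
    _ ≤ 2 ^ n * J := by gcongr
    _ ≤ _ := hsum

end Symmetrization

/-! ### Moments from the tau-norm, and the complexity in the extended reals. -/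

section Extended

/-- Convexity and `φ 0 = 0` give `φ p ≥ p φ 1` for `p ≥ 1`, and the normalization gives `φ 1 ≥ 1`
because the infimum defining `orliczInv φ 1` is attained. -/
theorem orliczInv_le_self {φ : ℝ → ℝ} (hφ : IsOrliczNFunction φ) (hφ1 : orliczInv φ 1 = 1)
    {p : ℝ} (hp : 1 ≤ p) : orliczInv φ p ≤ p := by
  have hbdd : ∀ y : ℝ, BddBelow {x : ℝ | 0 ≤ x ∧ y ≤ φ x} := fun y => ⟨0, fun x hx => hx.1⟩
  have h1 : (1 : ℝ) ≤ φ 1 := by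
    have hne : {x : ℝ | 0 ≤ x ∧ 1 ≤ φ x}.Nonempty := by
      obtain ⟨x, hx1, hx2⟩ := ((hφ.tendsto_atTop.eventually_ge_atTop 1).and
        (eventually_ge_atTop 1)).exists
      refine ⟨x, by linarith, ?_⟩
      rw [le_div_iff₀ (by linarith)] at hx1
      linarith
    have hcl : IsClosed {x : ℝ | 0 ≤ x ∧ 1 ≤ φ x} :=
      (isClosed_le continuous_const continuous_id).inter
        (isClosed_le continuous_const hφ.continuous)
    have := hcl.csInf_mem hne (hbdd 1)
    change orliczInv φ 1 ∈ _ at this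
    rw [hφ1] at this
    exact this.2
  refine csInf_le (hbdd p) ⟨by linarith, ?_⟩
  have hp0 : 0 < p := by linarith
  have hc := hφ.convex.2 (Set.mem_univ p) (Set.mem_univ (0 : ℝ))
    (show (0 : ℝ) ≤ 1 / p by positivity)
    (show (0 : ℝ) ≤ 1 - 1 / p from sub_nonneg.2 ((div_le_one hp0).2 hp)) (by ring)
  have e1 : (1 / p) • p + (1 - 1 / p) • (0 : ℝ) = 1 := by
    simp only [smul_eq_mul, mul_zero, add_zero]
    field_simp
  rw [e1, hφ.map_zero] at hc
  simp only [smul_eq_mul, mul_zero, add_zero] at hc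
  have h2 := h1.trans hc
  rw [one_div, inv_mul_eq_div, le_div_iff₀ hp0] at h2
  linarith

theorem eLpNorm_le_tauNorm_mul {Ω : Type*} [MeasurableSpace Ω] {μ : Measure Ω} {φ : ℝ → ℝ}
    (hφ : IsOrliczNFunction φ) (hφ1 : orliczInv φ 1 = 1) {Y : Ω → ℝ} {p : ℝ} (hp : 1 ≤ p) :
    eLpNorm Y (ENNReal.ofReal p) μ ≤ tauNorm φ Y μ * ENNReal.ofReal p := by
  have h1 : eLpNorm Y (ENNReal.ofReal p) μ / ENNReal.ofReal p ≤ tauNorm φ Y μ :=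
    (ENNReal.div_le_div_left (ENNReal.ofReal_le_ofReal (orliczInv_le_self hφ hφ1 hp)) _).trans
      (le_iSup₂ (f := fun (p : ℝ) (_ : 1 ≤ p) =>
        eLpNorm Y (ENNReal.ofReal p) μ / ENNReal.ofReal (orliczInv φ p)) p hp)
  rwa [ENNReal.div_le_iff (by simp; linarith) ENNReal.ofReal_ne_top] at h1

theorem moment_bound_of_tauNorm {Ω : Type*} [MeasurableSpace Ω] {μ : Measure Ω} {φ : ℝ → ℝ}
    (hφ : IsOrliczNFunction φ) (hφ1 : orliczInv φ 1 = 1) {Y : Ω → ℝ}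
    (hY : AEStronglyMeasurable Y μ) (htop : tauNorm φ Y μ ≠ ∞) {k : ℕ} (hk : 1 ≤ k) :
    Integrable (fun ω => |Y ω| ^ k) μ ∧
      ∫ ω, |Y ω| ^ k ∂μ ≤ ((tauNorm φ Y μ).toReal * k) ^ k := by
  have hk1 : (1 : ℝ) ≤ k := by exact_mod_cast hk
  have hle := eLpNorm_le_tauNorm_mul (μ := μ) (Y := Y) hφ hφ1 hk1
  rw [ENNReal.ofReal_natCast] at hle
  have hmem : MemLp Y k μ := ⟨hY, hle.trans_lt (ENNReal.mul_lt_top htop.lt_top (by simp))⟩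
  have hi : Integrable (fun ω => |Y ω| ^ k) μ := hmem.integrable_norm_pow (by omega)
  refine ⟨hi, ?_⟩
  have hnn : 0 ≤ ((tauNorm φ Y μ).toReal * k) ^ k := by positivity
  rw [← ENNReal.ofReal_le_ofReal_iff hnn,
    ofReal_integral_eq_lintegral_ofReal hi (ae_of_all _ fun ω => by positivity)]
  have h1 := eLpNorm_nnreal_pow_eq_lintegral (μ := μ) (f := Y) (p := (k : NNReal))
    (by exact_mod_cast (by omega : k ≠ 0))
  simp only [NNReal.coe_natCast, ENNReal.rpow_natCast, ENNReal.coe_natCast] at h1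
  calc ∫⁻ ω, ENNReal.ofReal (|Y ω| ^ k) ∂μ = ∫⁻ ω, ‖Y ω‖ₑ ^ k ∂μ := by
        refine lintegral_congr fun ω => ?_
        rw [ENNReal.ofReal_pow (abs_nonneg _), Real.enorm_eq_ofReal_abs]
    _ = eLpNorm Y k μ ^ k := h1.symm
    _ ≤ (tauNorm φ Y μ * k) ^ k := by gcongr
    _ = ENNReal.ofReal (((tauNorm φ Y μ).toReal * k) ^ k) := by
        rw [ENNReal.ofReal_pow (by positivity), ENNReal.ofReal_mul ENNReal.toReal_nonneg,
          ENNReal.ofReal_toReal htop, ENNReal.ofReal_natCast]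

theorem extExpectation_of_nonneg {Ω : Type*} [MeasurableSpace Ω] (μ : Measure Ω) {f : Ω → EReal}
    (hf : ∀ ω, 0 ≤ f ω) :
    extExpectation μ f = ((∫⁻ ω, (f ω).toENNReal ∂μ : ℝ≥0∞) : EReal) := by
  have : ∀ ω, (-f ω).toENNReal = 0 := fun ω =>
    EReal.toENNReal_of_nonpos (by simpa using EReal.neg_le_neg_iff.2 (hf ω))
  simp [extExpectation, this]

/-- No boundedness is assumed: if the real family is unbounded above, its supremum is a default
value, but then `T` can only be `⊤`. -/
theorem EReal.coe_ciSup_le {ι : Type*} [Nonempty ι] {a : ι → ℝ} {T : EReal}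
    (h : ∀ i, (a i : EReal) ≤ T) : ((⨆ i, a i : ℝ) : EReal) ≤ T := by
  induction T with
  | top => exact le_top
  | bot => exact absurd (h (Classical.arbitrary ι)) (by simp)
  | coe r => exact EReal.coe_le_coe_iff.2 (ciSup_le fun i => EReal.coe_le_coe_iff.1 (h i))

theorem EReal.coe_sum_le_sum {α : Type*} {s : Finset α} {a : α → ℝ} {T : α → EReal}
    (h : ∀ i ∈ s, (a i : EReal) ≤ T i) : ((∑ i ∈ s, a i : ℝ) : EReal) ≤ ∑ i ∈ s, T i := by
  classical
  induction s using Finset.induction_on with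
  | empty => simp
  | insert i s hi ih =>
    rw [Finset.sum_insert hi, Finset.sum_insert hi, EReal.coe_add]
    exact add_le_add (h i (Finset.mem_insert_self i s))
      (ih fun j hj => h j (Finset.mem_insert_of_mem hj))

variable {E : Type*} {n : ℕ} {G : Set (E → ℝ)}

/-- Real minorants of the separate suprema suffice for lower bounds, which avoids sums in `EReal`
that mix infinities. -/
theorem le_rademacherComplexity {x : Fin n → E} {a : (Fin n → ℤˣ) → ℝ}
    (h : ∀ ε, (a ε : EReal) ≤ ⨆ g ∈ G, ((∑ i, ((ε i : ℤ) : ℝ) * g (x i) : ℝ) : EReal)) :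
    ((2 / (n : ℝ) * (1 / 2 ^ n) * ∑ ε, a ε : ℝ) : EReal) ≤ rademacherComplexity G x := by
  rw [EReal.coe_mul]
  refine mul_le_mul_of_nonneg_left (EReal.coe_sum_le_sum fun ε _ => h ε) ?_
  exact EReal.coe_nonneg.2 (by positivity)

theorem coe_signedSup_le_rademacherComplexity [Nonempty G] (x : Fin n → E) :
    ((2 / (n : ℝ) * (1 / 2 ^ n) * ∑ ε, signedSup (fun g : G => g.1) ε x : ℝ) : EReal) ≤
      rademacherComplexity G x :=
  le_rademacherComplexity fun ε => EReal.coe_ciSup_le fun g =>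
    le_iSup₂ (f := fun (g : E → ℝ) (_ : g ∈ G) =>
      ((∑ i, ((ε i : ℤ) : ℝ) * g (x i) : ℝ) : EReal)) g.1 g.2

/-- A single member of the class already gives the minorant zero, because its signed sums cancel
under `ε ↦ -ε`. -/
theorem rademacherComplexity_nonneg (hG : G.Nonempty) (x : Fin n → E) :
    0 ≤ rademacherComplexity G x := by
  obtain ⟨g, hg⟩ := hG
  have h := le_rademacherComplexity (G := G) (x := x)
    (a := fun ε => ∑ i, ((ε i : ℤ) : ℝ) * g (x i)) fun ε =>
    le_iSup₂ (f := fun (g : E → ℝ) (_ : g ∈ G) =>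
      ((∑ i, ((ε i : ℤ) : ℝ) * g (x i) : ℝ) : EReal)) g hg
  have h0 : ∑ ε : Fin n → ℤˣ, ∑ i, ((ε i : ℤ) : ℝ) * g (x i) = 0 := by
    have h1 : ∑ ε : Fin n → ℤˣ, ∑ i, (((-ε) i : ℤ) : ℝ) * g (x i) =
        ∑ ε : Fin n → ℤˣ, ∑ i, ((ε i : ℤ) : ℝ) * g (x i) :=
      Equiv.sum_comp (Equiv.neg (Fin n → ℤˣ)) fun ε => ∑ i, ((ε i : ℤ) : ℝ) * g (x i)
    simp only [Pi.neg_apply, Units.val_neg, Int.cast_neg, neg_mul, Finset.sum_neg_distrib] at h1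
    linarith
  rw [h0, mul_zero] at h
  exact_mod_cast h

theorem rademacherComplexity_eq_top_of_iSup_eq_top (hn : n ≠ 0) (hG : G.Nonempty) {x : Fin n → E}
    {ε₀ : Fin n → ℤˣ}
    (htop : ⨆ g ∈ G, ((∑ i, ((ε₀ i : ℤ) : ℝ) * g (x i) : ℝ) : EReal) = ⊤) :
    rademacherComplexity G x = ⊤ := by
  classical
  obtain ⟨g, hg⟩ := hG
  rw [EReal.eq_top_iff_forall_lt]
  intro y
  set b : (Fin n → ℤˣ) → ℝ := fun ε => ∑ i, ((ε i : ℤ) : ℝ) * g (x i)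
  set C : ℝ := 2 / (n : ℝ) * (1 / 2 ^ n)
  have hn0 : (0 : ℝ) < n := by positivity
  have hC : 0 < C := by positivity
  -- At `ε₀` any real minorant is allowed; this one makes the normalized total equal to `y + 1`.
  -- Elsewhere the fixed member `g` supplies finite minorants.
  have h := le_rademacherComplexity (G := G) (x := x)
    (a := Function.update b ε₀ ((y + 1) / C - ∑ ε ∈ Finset.univ \ {ε₀}, b ε)) fun ε => by
      rcases eq_or_ne ε ε₀ with rfl | hne
      · rw [htop]; exact le_top
      · rw [Function.update_of_ne hne]
        exact le_iSup₂ (f := fun (g : E → ℝ) (_ : g ∈ G) =>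
          ((∑ i, ((ε i : ℤ) : ℝ) * g (x i) : ℝ) : EReal)) g hg
  rw [Finset.sum_update_of_mem (Finset.mem_univ _), sub_add_cancel] at h
  refine lt_of_lt_of_le (EReal.coe_lt_coe_iff.2 ?_) h
  change y < C * _
  rw [mul_div_cancel₀ _ hC.ne']
  linarith

/-- If the class is not bounded at one point, the Rademacher complexity is infinite. -/
theorem rademacherComplexity_eq_top_of_unbounded {E : Type*} [NormedAddCommGroup E]
    {G : Set (E → ℝ)} {L : ℝ} (hn : n ≠ 0) (hG : ∀ g ∈ G, ∀ x y : E, g x - g y ≤ L * ‖x - y‖)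
    (hunb : ¬ ∃ M, ∀ g ∈ G, |g 0| ≤ M) (x : Fin n → E) : rademacherComplexity G x = ⊤ := by
  have hne : G.Nonempty := by
    by_contra hem
    exact hunb ⟨0, fun g hg => absurd ⟨g, hg⟩ hem⟩
  have hn0 : (0 : ℝ) < n := by positivity
  by_contra hcon
  -- Only the two constant sign vectors are needed: together they bound `|∑ g (x i)|` over the
  -- class, and the Lipschitz condition carries this to `|g 0|`.
  have hbd : ∀ e : ℤˣ, ∃ c : ℝ, ∀ g ∈ G, ((e : ℤ) : ℝ) * ∑ i, g (x i) ≤ c := fun e => by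
    have h1 : ⨆ g ∈ G, ((∑ i, (((fun _ => e : Fin n → ℤˣ) i : ℤ) : ℝ) * g (x i) : ℝ) : EReal) ≠ ⊤ :=
      fun h => hcon (rademacherComplexity_eq_top_of_iSup_eq_top hn hne h)
    set T := ⨆ g ∈ G, ((∑ i, (((fun _ => e : Fin n → ℤˣ) i : ℤ) : ℝ) * g (x i) : ℝ) : EReal)
    refine ⟨T.toReal, fun g hg => EReal.coe_le_coe_iff.1 (le_trans ?_ (EReal.le_coe_toReal h1))⟩
    rw [Finset.mul_sum]
    exact le_iSup₂ (f := fun (g : E → ℝ) (_ : g ∈ G) =>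
      ((∑ i, (((fun _ => e : Fin n → ℤˣ) i : ℤ) : ℝ) * g (x i) : ℝ) : EReal)) g hg
  obtain ⟨c, hc⟩ := hbd 1
  obtain ⟨d, hd⟩ := hbd (-1)
  refine hunb ⟨(max c d + ∑ i, L * ‖x i‖) / n, fun g hg => ?_⟩
  have h1 : ∑ i : Fin n, g 0 ≤ ∑ i, g (x i) + ∑ i, L * ‖x i‖ := by
    rw [← Finset.sum_add_distrib]
    refine Finset.sum_le_sum fun i _ => ?_
    have := hG g hg 0 (x i)
    rw [zero_sub, norm_neg] at this
    linarith
  have h2 : ∑ i, g (x i) ≤ ∑ i : Fin n, g 0 + ∑ i, L * ‖x i‖ := by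
    rw [← Finset.sum_add_distrib]
    refine Finset.sum_le_sum fun i _ => ?_
    have := hG g hg (x i) 0
    rw [sub_zero] at this
    linarith
  simp only [Finset.sum_const, Finset.card_univ, Fintype.card_fin, nsmul_eq_mul] at h1 h2
  have h3 := hc g hg
  have h4 := hd g hg
  simp only [Units.val_one, Int.cast_one, one_mul, Units.val_neg, Int.cast_neg, neg_mul] at h3 h4
  rw [le_div_iff₀ hn0]
  rcases abs_cases (g 0) with ⟨h, _⟩ | ⟨h, _⟩ <;> rw [h]
  · linarith [le_max_left c d]
  · linarith [le_max_right c d]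

theorem ofReal_integral_le_lintegral_ofReal {α : Type*} [MeasurableSpace α] {ν : Measure α}
    {f : α → ℝ} (hf : Integrable f ν) :
    ENNReal.ofReal (∫ x, f x ∂ν) ≤ ∫⁻ x, ENNReal.ofReal (f x) ∂ν := by
  calc ENNReal.ofReal (∫ x, f x ∂ν) ≤ ENNReal.ofReal (∫ x, max (f x) 0 ∂ν) :=
        ENNReal.ofReal_le_ofReal (integral_mono hf hf.pos_part fun x => le_max_left _ _)
    _ = ∫⁻ x, ENNReal.ofReal (max (f x) 0) ∂ν :=
        ofReal_integral_eq_lintegral_ofReal hf.pos_part (ae_of_all _ fun x => le_max_right _ _)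
    _ = _ := by simp [ENNReal.ofReal_max]

end Extended

/-! ### Reduction to a separable subspace and assembly. -/

section Main

/-- The generalization bound for a class of Lipschitz functions bounded at a point, on a separable
space. -/
theorem measure_supDeviation_le_ge {ι : Type*} [Nonempty ι] {E : Type*} [NormedAddCommGroup E]
    [MeasurableSpace E] [BorelSpace E] [SecondCountableTopology E] {ν : Measure E}
    [IsProbabilityMeasure ν] {h : ι → E → ℝ} {K L M : ℝ} (hK : 0 < K) (hL0 : 0 < L)
    (hint : ∀ k : ℕ, 1 ≤ k → Integrable (fun x : E => ‖x‖ ^ k) ν)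
    (hmom : ∀ k : ℕ, 1 ≤ k → ∫ x, ‖x‖ ^ k ∂ν ≤ (K * k) ^ k)
    (hL : ∀ i x y, h i x - h i y ≤ L * ‖x - y‖) (hM : ∀ i, |h i 0| ≤ M) {n : ℕ} (hn : n ≠ 0)
    {u : ℝ} (hu : 0 < u) (hun : u ≤ n) :
    ENNReal.ofReal (1 - Real.exp (-u)) ≤ (Measure.pi fun _ : Fin n => ν)
      {x | supDeviation h ν x ≤ (∫ y, 2 / (n : ℝ) * (1 / 2 ^ n) *
        ∑ ε : Fin n → ℤˣ, signedSup h ε y ∂(Measure.pi fun _ => ν)) +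
        12 * Real.exp 1 * L * √(u / n) * K} := by
  have hν : Integrable (fun x : E => ‖x‖) ν := by simpa using hint 1 le_rfl
  refine (measure_sub_integral_le_ge hK hint hmom hn hL0
    (supDeviation_sub_le hL0.le hL hM hν) hu hun).trans (measure_mono fun x hx => ?_)
  have := integral_supDeviation_le hL0.le hL hM hν hn
  simp only [Set.mem_ofPred_eq] at hx ⊢
  linarith

variable {Ω : Type*} [MeasurableSpace Ω] {μ : Measure Ω} [IsProbabilityMeasure μ]
  {E : Type*} [NormedAddCommGroup E] [NormedSpace ℝ E] [MeasurableSpace E] [BorelSpace E]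

omit [IsProbabilityMeasure μ] in
/-- An identically distributed strongly measurable family takes values in a separable closed
subspace, up to null sets. -/
theorem exists_separable_submodule {ι : Type*} {X : ι → Ω → E} {i₀ : ι}
    (hmeas : AEStronglyMeasurable (X i₀) μ) (hident : ∀ i, IdentDistrib (X i) (X i₀) μ μ) :
    ∃ S : Submodule ℝ E, IsClosed (S : Set E) ∧ TopologicalSpace.IsSeparable (S : Set E) ∧
      ∀ i, ∀ᵐ ω ∂μ, X i ω ∈ S := by
  obtain ⟨t, ht, hXt⟩ := hmeas.isSeparable_ae_range
  -- The closed span rather than `t` itself: it is measurable, separable, and a normed group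
  -- containing `0`.
  refine ⟨(Submodule.span ℝ t).topologicalClosure, Submodule.isClosed_topologicalClosure _,
    ?_, fun i => ?_⟩
  · rw [Submodule.topologicalClosure_coe]
    exact (ht.span (R := ℝ)).closure
  · refine (hident i).symm.ae_snd (p := fun x => x ∈ (Submodule.span ℝ t).topologicalClosure)
      (Submodule.isClosed_topologicalClosure _).measurableSet ?_
    filter_upwards [hXt] with ω hω
    exact Submodule.le_topologicalClosure _ (Submodule.subset_span hω)

/-- The generalization bound when the norm is not degenerate and the class is bounded at a
point. -/
theorem generalization_bound_of_bounded
    {φ : ℝ → ℝ} (hφ : IsOrliczNFunction φ) (hφ1 : orliczInv φ 1 = 1)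
    {n : ℕ} [NeZero n] {X : Fin n → Ω → E}
    (hmeas : ∀ i, AEStronglyMeasurable (X i) μ)
    (hindep : iIndepFun X μ) (hident : ∀ i, IdentDistrib (X i) (X 0) μ μ)
    {G : Set (E → ℝ)} (hne : G.Nonempty) {L M : ℝ} (hL0 : 0 < L)
    (hG : ∀ g ∈ G, ∀ x y : E, g x - g y ≤ L * ‖x - y‖) (hM : ∀ g ∈ G, |g 0| ≤ M)
    (htau0 : tauNorm φ (fun ω' => ‖X 0 ω'‖) μ ≠ 0) (htau : tauNorm φ (fun ω' => ‖X 0 ω'‖) μ ≠ ∞)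
    {u : ℝ} (hu : 0 < u) (hun : u ≤ n) :
    ENNReal.ofReal (1 - Real.exp (-u)) ≤
      μ {ω | (⨆ g ∈ G, ((1 / (n : ℝ) * ∑ i, g (X i ω) - ∫ ω', g (X 0 ω') ∂μ : ℝ) : EReal)) ≤
        extExpectation μ (fun ω' => rademacherComplexity G (fun i => X i ω')) +
          ((12 * Real.exp 1 * L * √(u / (n : ℝ)) : ℝ) : EReal) *
            (tauNorm φ (fun ω' => ‖X 0 ω'‖) μ : EReal)} := by
  classical
  have hn : n ≠ 0 := NeZero.ne n
  have : Nonempty G := hne.to_subtype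
  obtain ⟨S, hScl, hSsep, hXS⟩ := exists_separable_submodule (hmeas 0) hident
  have : SecondCountableTopology S := hSsep.secondCountableTopology
  -- The value `0` outside `S` is taken only on a null set of the sample. On `S` second countability
  -- makes the product Borel, so the Lipschitz functions of the whole sample are measurable.
  set r : E → S := fun x => if hx : x ∈ (S : Set E) then ⟨x, hx⟩ else 0 with hr
  have hrm : Measurable r := Measurable.dite measurable_id measurable_const hScl.measurableSet
  have hXm : ∀ i, AEMeasurable (X i) μ := fun i => (hmeas i).aemeasurable
  set Y : Fin n → Ω → S := fun i => r ∘ X i with hY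
  have hYm : ∀ i, AEMeasurable (Y i) μ := fun i => hrm.comp_aemeasurable (hXm i)
  have hYX : ∀ i, ∀ᵐ ω ∂μ, (Y i ω : E) = X i ω := fun i => by
    filter_upwards [hXS i] with ω hω
    simp only [hY, hr, Function.comp_apply, SetLike.mem_coe, hω, dif_pos]
  have hYX' : ∀ᵐ ω ∂μ, ∀ i, (Y i ω : E) = X i ω := ae_all_iff.2 hYX
  set ν := μ.map (Y 0) with hν
  have : IsProbabilityMeasure ν := Measure.isProbabilityMeasure_map (hYm 0)
  have hmap : μ.map (fun ω i => Y i ω) = Measure.pi fun _ : Fin n => ν := by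
    have h1 : iIndepFun Y μ := hindep.comp (fun _ => r) fun _ => hrm
    rw [(iIndepFun_iff_map_fun_eq_pi_map hYm).1 h1]
    congr 1
    funext i
    exact ((hident i).comp hrm).map_eq
  have hYm' : AEMeasurable (fun ω i => Y i ω) μ := aemeasurable_pi_lambda _ hYm
  set K := (tauNorm φ (fun ω' => ‖X 0 ω'‖) μ).toReal with hK
  have hK0 : 0 < K := ENNReal.toReal_pos htau0 htau
  have hmoment := fun (k : ℕ) (hk : 1 ≤ k) =>
    moment_bound_of_tauNorm hφ hφ1 (hmeas 0).norm htau hk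
  simp only [abs_norm] at hmoment
  have hnorm : ∀ k : ℕ, (fun ω => ‖X 0 ω‖ ^ k) =ᵐ[μ] (fun y : S => ‖y‖ ^ k) ∘ Y 0 := fun k => by
    filter_upwards [hYX 0] with ω hω
    simp only [Function.comp_apply, ← hω, Submodule.coe_norm]
  have hint : ∀ k : ℕ, 1 ≤ k → Integrable (fun y : S => ‖y‖ ^ k) ν := fun k hk =>
    (integrable_map_measure (by fun_prop) (hYm 0)).2 ((hmoment k hk).1.congr (hnorm k))
  have hmom : ∀ k : ℕ, 1 ≤ k → ∫ y : S, ‖y‖ ^ k ∂ν ≤ (K * k) ^ k := fun k hk => by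
    rw [hν, integral_map (hYm 0) (by fun_prop)]
    exact (integral_congr_ae (hnorm k)).symm.le.trans (hmoment k hk).2
  set h : G → S → ℝ := fun g y => g.1 y with hh
  have hL : ∀ g x y, h g x - h g y ≤ L * ‖x - y‖ := fun g x y => hG g.1 g.2 x y
  have hM' : ∀ g, |h g 0| ≤ M := fun g => hM g.1 g.2
  have hν1 : Integrable (fun x : S => ‖x‖) ν := by simpa using hint 1 le_rfl
  have hcore := measure_supDeviation_le_ge hK0 hL0 hint hmom hL hM' hn hu hun
  set R : (Fin n → S) → ℝ := fun y => 2 / (n : ℝ) * (1 / 2 ^ n) *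
    ∑ ε : Fin n → ℤˣ, signedSup h ε y with hR
  have hRi : Integrable R (Measure.pi fun _ : Fin n => ν) :=
    (integrable_finsetSum _ fun ε _ => integrable_signedSup hL0.le hL hM' hν1 ε).const_mul _
  have hext : ((∫ y, R y ∂(Measure.pi fun _ : Fin n => ν) : ℝ) : EReal) ≤
      extExpectation μ (fun ω' => rademacherComplexity G (fun i => X i ω')) := by
    rw [extExpectation_of_nonneg μ fun ω => rademacherComplexity_nonneg hne _]
    -- The complexity itself need not be measurable: its lower integral only has to dominate the
    -- integral of the measurable minorant `R`.
    have h1 : ENNReal.ofReal (∫ y, R y ∂(Measure.pi fun _ : Fin n => ν)) ≤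
        ∫⁻ ω, (rademacherComplexity G (fun i => X i ω)).toENNReal ∂μ := by
      refine (ofReal_integral_le_lintegral_ofReal hRi).trans ?_
      rw [← hmap] at hRi ⊢
      rw [lintegral_map' hRi.1.aemeasurable.ennreal_ofReal hYm']
      refine lintegral_mono_ae ?_
      filter_upwards [hYX'] with ω hω
      rw [← EReal.real_coe_toENNReal]
      apply EReal.toENNReal_le_toENNReal
      simp_rw [← hω]
      exact coe_signedSup_le_rademacherComplexity fun i => (Y i ω : E)
    refine le_trans ?_ (EReal.coe_ennreal_le_coe_ennreal_iff.2 h1)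
    rw [EReal.coe_ennreal_ofReal]
    exact EReal.coe_le_coe_iff.2 (le_max_left _ _)
  have hms : MeasurableSet {x | supDeviation h ν x ≤
      (∫ y, R y ∂(Measure.pi fun _ : Fin n => ν)) + 12 * Real.exp 1 * L * √(u / n) * K} :=
    measurableSet_le (continuous_of_sub_le_mul_sum (by positivity)
      (supDeviation_sub_le hL0.le hL hM' hν1)).measurable measurable_const
  refine hcore.trans ?_
  rw [← hmap] at hms hext ⊢
  rw [Measure.map_apply_of_aemeasurable hYm' hms]
  refine measure_mono_ae ?_
  filter_upwards [hYX'] with ω hω hmem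
  refine iSup₂_le fun g hg => ?_
  have hmean : ∫ ω', g (X 0 ω') ∂μ = ∫ y, h ⟨g, hg⟩ y ∂ν := by
    rw [hν, integral_map (hYm 0)
      (continuous_of_sub_le_mul_norm hL0.le (hL ⟨g, hg⟩)).aestronglyMeasurable]
    refine integral_congr_ae ?_
    filter_upwards [hYX 0] with ω' hω'
    simp only [hh, hω']
  have hdev := (le_ciSup (bddAbove_supDeviation hL0.le hL hM' hν1 fun i => Y i ω) ⟨g, hg⟩).trans hmem
  simp only [hh, hω] at hdev
  rw [hmean]
  refine (EReal.coe_le_coe_iff.2 hdev).trans ?_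
  rw [EReal.coe_add, EReal.coe_mul _ K]
  refine add_le_add hext (le_of_eq ?_)
  rw [hK, EReal.coe_ennreal_toReal htau]

end Main

/-- If the Lipschitz constant is not positive or the norm vanishes, the class is constant along the
sample. -/
theorem degenerate_class {Ω : Type*} [MeasurableSpace Ω] {μ : Measure Ω}
    {E : Type*} [NormedAddCommGroup E] [MeasurableSpace E] [BorelSpace E]
    {φ : ℝ → ℝ} (hφ : IsOrliczNFunction φ) (hφ1 : orliczInv φ 1 = 1)
    {n : ℕ} [NeZero n] {X : Fin n → Ω → E}
    (hmeas : ∀ i, AEStronglyMeasurable (X i) μ) (hident : ∀ i, IdentDistrib (X i) (X 0) μ μ)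
    {G : Set (E → ℝ)} (hne : G.Nonempty) {L : ℝ}
    (hG : ∀ g ∈ G, ∀ x y : E, g x - g y ≤ L * ‖x - y‖)
    (hdeg : L ≤ 0 ∨ tauNorm φ (fun ω' => ‖X 0 ω'‖) μ = 0) :
    (∀ᵐ ω ∂μ, ∀ g ∈ G, ∀ i, g (X i ω) = g 0) ∧
      (L : EReal) * (tauNorm φ (fun ω' => ‖X 0 ω'‖) μ : EReal) = 0 := by
  by_cases htau : tauNorm φ (fun ω' => ‖X 0 ω'‖) μ = 0
  · refine ⟨?_, by simp [htau]⟩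
    have h1 := eLpNorm_le_tauNorm_mul (μ := μ) (Y := fun ω' => ‖X 0 ω'‖) hφ hφ1 le_rfl
    rw [htau, zero_mul, nonpos_iff_eq_zero, ENNReal.ofReal_one, eLpNorm_norm,
      eLpNorm_eq_zero_iff (hmeas 0) one_ne_zero] at h1
    have h2 : ∀ i, ∀ᵐ ω ∂μ, X i ω = 0 := fun i =>
      (hident i).symm.ae_snd (p := fun x => x = 0) (measurableSet_singleton 0) h1
    filter_upwards [ae_all_iff.2 h2] with ω hω g _ i
    rw [hω i]
  · have hL := hdeg.resolve_right htau
    have hc : ∀ g ∈ G, ∀ x, g x = g 0 := fun g hg x => by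
      have h1 := hG g hg x 0
      have h2 := hG g hg 0 x
      have h3 := mul_nonpos_of_nonpos_of_nonneg hL (norm_nonneg (x - 0))
      have h4 := mul_nonpos_of_nonpos_of_nonneg hL (norm_nonneg (0 - x))
      linarith
    refine ⟨ae_of_all _ fun ω g hg i => hc g hg _, ?_⟩
    rcases hL.eq_or_lt with rfl | hlt
    · simp
    -- A negative constant gives `0 ≤ L * ‖x‖`, so the space is trivial and the tau-norm would
    -- vanish.
    · obtain ⟨g, hg⟩ := hne
      have hx : ∀ x : E, ‖x‖ = 0 := fun x => by
        have h1 := hG g hg x 0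
        rw [hc g hg x, sub_self, sub_zero] at h1
        exact le_antisymm (by nlinarith) (norm_nonneg x)
      exact absurd (by simp [tauNorm, hx]) htau

theorem mainTheorem7 {Ω : Type*} [MeasurableSpace Ω] (μ : Measure Ω) [IsProbabilityMeasure μ]
    {E : Type*} [NormedAddCommGroup E] [NormedSpace ℝ E] [CompleteSpace E]
    [MeasurableSpace E] [BorelSpace E]
    (φ : ℝ → ℝ) (hφ : IsOrliczNFunction φ) (hφ1 : orliczInv φ 1 = 1)
    (n : ℕ) [NeZero n] (X : Fin n → Ω → E)
    (hmeas : ∀ i, AEStronglyMeasurable (X i) μ)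
    (hindep : iIndepFun X μ) (hident : ∀ i, IdentDistrib (X i) (X 0) μ μ)
    (G : Set (E → ℝ)) (L : ℝ) (hG : ∀ g ∈ G, ∀ x y : E, g x - g y ≤ L * ‖x - y‖)
    (δ : ℝ) (hδ : 0 < δ) (hδ1 : 1 ≤ Real.log (1 / δ)) (hδn : Real.log (1 / δ) ≤ (n : ℝ)) :
    ENNReal.ofReal (1 - δ) ≤
      μ {ω | (⨆ g ∈ G, ((1 / (n : ℝ) * ∑ i, g (X i ω) - ∫ ω', g (X 0 ω') ∂μ : ℝ) : EReal)) ≤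
        extExpectation μ (fun ω' => rademacherComplexity G (fun i => X i ω')) +
          ((12 * Real.exp 1 * L * √(Real.log (1 / δ) / (n : ℝ)) : ℝ) : EReal) *
            (tauNorm φ (fun ω' => ‖X 0 ω'‖) μ : EReal)} := by
  have hn0 : (0 : ℝ) < n := by exact_mod_cast Nat.pos_of_ne_zero (NeZero.ne n)
  have hfull : ∀ s : Set Ω, (∀ᵐ ω ∂μ, ω ∈ s) → ENNReal.ofReal (1 - δ) ≤ μ s := fun s hs => by
    have h1 : μ s = 1 := (measure_congr (eventuallyEq_univ.2 hs)).trans measure_univ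
    rw [h1]
    exact ENNReal.ofReal_le_one.2 (by linarith)
  rcases G.eq_empty_or_nonempty with rfl | hne
  · exact hfull _ (ae_of_all _ fun ω => by simp)
  have hext : 0 ≤ extExpectation μ (fun ω' => rademacherComplexity G (fun i => X i ω')) := by
    rw [extExpectation_of_nonneg μ fun ω => rademacherComplexity_nonneg hne _]
    exact EReal.coe_ennreal_nonneg _
  by_cases hdeg : L ≤ 0 ∨ tauNorm φ (fun ω' => ‖X 0 ω'‖) μ = 0
  · obtain ⟨hconst, hterm⟩ := degenerate_class hφ hφ1 hmeas hident hne hG hdeg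
    refine hfull _ ?_
    filter_upwards [hconst] with ω hω
    refine iSup₂_le fun g hg => ?_
    have hmean : ∫ ω', g (X 0 ω') ∂μ = g 0 := by
      rw [integral_congr_ae (g := fun _ => g 0) (hconst.mono fun ω' hω' => hω' g hg 0)]
      simp
    have h0 : 1 / (n : ℝ) * ∑ i, g (X i ω) - ∫ ω', g (X 0 ω') ∂μ = 0 := by
      rw [hmean, Finset.sum_congr rfl fun i _ => hω g hg i]
      simp [hn0.ne']
    -- Group `L` with the tau-norm first: when `L = 0` the norm may be infinite, and the product is
    -- zero by the convention `0 * ∞ = 0`.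
    rw [h0, mul_right_comm, EReal.coe_mul, mul_assoc, hterm]
    simpa using hext
  push Not at hdeg
  obtain ⟨hL0, htau0⟩ := hdeg
  have hu : 0 < Real.log (1 / δ) := by linarith
  have hcoef : 0 < 12 * Real.exp 1 * L * √(Real.log (1 / δ) / (n : ℝ)) := by
    have := Real.sqrt_pos.2 (div_pos hu hn0)
    have := Real.exp_pos 1
    positivity
  -- The complexity term is nonnegative, hence not `⊥`, so adding `⊤` to it gives `⊤`.
  by_cases htau : tauNorm φ (fun ω' => ‖X 0 ω'‖) μ = ∞
  · refine hfull _ (ae_of_all _ fun ω => ?_)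
    rw [Set.mem_ofPred_eq, htau, EReal.coe_ennreal_top, EReal.coe_mul_top_of_pos hcoef,
      EReal.add_top_of_ne_bot (ne_of_gt (lt_of_lt_of_le EReal.bot_lt_zero hext))]
    exact le_top
  by_cases hbd : ∃ M, ∀ g ∈ G, |g 0| ≤ M
  · obtain ⟨M, hM⟩ := hbd
    have h := generalization_bound_of_bounded hφ hφ1 hmeas hindep hident hne hL0 hG hM htau0 htau
      hu hδn
    rwa [show Real.exp (-Real.log (1 / δ)) = δ by
      rw [one_div, Real.log_inv, neg_neg, Real.exp_log hδ]] at h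
  · refine hfull _ (ae_of_all _ fun ω => ?_)
    have htop : extExpectation μ (fun ω' => rademacherComplexity G (fun i => X i ω')) = ⊤ := by
      rw [extExpectation_of_nonneg μ fun ω => rademacherComplexity_nonneg hne _]
      simp [rademacherComplexity_eq_top_of_unbounded (NeZero.ne n) hG hbd]
    rw [Set.mem_ofPred_eq, htop, EReal.top_add_of_ne_bot]
    · exact le_top
    · refine ne_of_gt (lt_of_lt_of_le EReal.bot_lt_zero ?_)
      exact mul_nonneg (EReal.coe_nonneg.2 hcoef.le) (EReal.coe_ennreal_nonneg _)
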